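/- Let $\pi\ge 0$ be a fixed integer and let $\Delta$ be the set of probability distributions on $\mathbb R^\pi$ with finite second moment, with the coarsest topology that makes $F\mapsto \int\gamma\,dF$ continuous for every continuous $\gamma:\mathbb R^\pi\to\mathbb R$ such that $\gamma(x)/(1+\|x\|^2)$ is bounded. Let $\rho_2$ be the Wasserstein metric of order two, $$\rho_2(\mu,\nu)=\Bigl(\inf\{\mathrm E\|U-V\|^2 : U\sim\mu,\ V\sim\nu\}\Bigr)^{1/2}.$$ For a real $n\times\pi$ matrix $M$ with columns $M_1,\dots,M_\pi$ and a probability distribution $G$ on $\mathbb R^\pi$, let $\mathcal L_G$ denote the joint law of $(M_1^{\rm T}Y_1,\dots,M_\pi^{\rm T}Y_\pi)$, where $Y_1,\dots,Y_\pi$ are the columns of an $n\times\pi$ random matrix $Y$ whose rows are independent with distribution $G$. Let $\Delta_0$ be a fixed compact subset of $\Delta$ and $\delta$ a fixed real number. For each $n$ let $F=F_n$ be an element of $\Delta_0$, let $X=X_n$ be an $n\times\pi$ random matrix whose rows are independent with distribution $F_n$, and let $M=M^{(n)}$ be a (non-random) $n\times\pi$ matrix each of whose columns $M_i$ satisfies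 $\sum_{j=1}^n M_{ji}=0$ and $\sum_{j=1}^n M_{ji}^2\le\delta^2$. Let $\hat F=\hat F_n$ be the empirical distribution of the $n$ rows of $X_n$. Then, as $n\to\infty$, $$\rho_2(\mathcal L_F,\mathcal L_{\hat F})\to 0\quad\text{in probability,}$$ where both laws are formed with the matrix $M^{(n)}$, and $\mathcal L_{\hat F}$ is the conditional law given $X_n$. -/

import Mathlib

open MeasureTheory ProbabilityTheory Filter Topology
open scoped ENNReal

noncomputable section

/-- The space `Δ` of probability distributions on `ℝ^p` (with its Euclidean norm) that have finite
variance, that is, a finite second moment. -/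
structure FiniteVarianceLaw (p : ℕ) where
  /-- the distribution, as a Borel measure -/
  law : Measure (EuclideanSpace ℝ (Fin p))
  isProbabilityMeasure_law : IsProbabilityMeasure law
  lintegral_sq_lt_top : ∫⁻ x, ‖x‖ₑ ^ 2 ∂law < ∞

/-- The test functions of convergence in distribution together with second moments: continuous
functions `γ` on `ℝ^p` for which `γ x / (1 + ‖x‖ ^ 2)` is bounded. -/
def QuadraticGrowthFun (p : ℕ) : Type :=
  {γ : EuclideanSpace ℝ (Fin p) → ℝ //
    Continuous γ ∧ ∃ C : ℝ, ∀ x, |γ x / (1 + ‖x‖ ^ 2)| ≤ C}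

/-- The topology on `Δ` of convergence of `E_F (γ (X))` for every test function `γ`: the coarsest
topology that makes each map `F ↦ ∫ γ dF` continuous. -/
instance FiniteVarianceLaw.instTopologicalSpace (p : ℕ) :
    TopologicalSpace (FiniteVarianceLaw p) :=
  TopologicalSpace.induced
    (fun (F : FiniteVarianceLaw p) (γ : QuadraticGrowthFun p) => ∫ x, γ.1 x ∂F.law)
    inferInstance

/-- The Wasserstein distance of order two, `ρ₂ (μ, ν) = (inf E ‖U - V‖²) ^ (1/2)`, the infimum
being over all joint laws of pairs `(U, V)` with `U` distributed as `μ` and `V` as `ν`. It is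
finite when `μ` and `ν` are probability measures with finite second moments. -/
def wasserstein₂ {p : ℕ} (μ ν : Measure (EuclideanSpace ℝ (Fin p))) : ℝ≥0∞ :=
  (⨅ (c : Measure (EuclideanSpace ℝ (Fin p) × EuclideanSpace ℝ (Fin p)))
    (_ : c.map Prod.fst = μ ∧ c.map Prod.snd = ν),
      ∫⁻ z, ‖z.1 - z.2‖ₑ ^ 2 ∂c) ^ (1 / 2 : ℝ)

/-- The vector `(M₁ᵀ X₁, …, M_pᵀ X_p)`, where `M_k` is the `k`-th column of the `n × p` matrix `M`
and `X_k` is the `k`-th column of the `n × p` matrix whose rows are `x 0, …, x (n - 1)`. -/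
def columnContrasts {n p : ℕ} (M : Matrix (Fin n) (Fin p) ℝ)
    (x : Fin n → EuclideanSpace ℝ (Fin p)) : EuclideanSpace ℝ (Fin p) :=
  WithLp.toLp 2 (fun k => ∑ j, M j k * x j k)

/-- `𝓛_F`: the joint law of the column contrasts `(M₁ᵀ X₁, …, M_pᵀ X_p)` when the `n` rows of `X`
are independent and each has distribution `F`. -/
def contrastLaw {n p : ℕ} (M : Matrix (Fin n) (Fin p) ℝ)
    (F : Measure (EuclideanSpace ℝ (Fin p))) : Measure (EuclideanSpace ℝ (Fin p)) :=
  (Measure.pi fun _ : Fin n => F).map (columnContrasts M)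

/-- The empirical distribution of the `n` points `x 0, …, x (n - 1)`: mass `1 / n` at each of
them, counted with multiplicity. -/
def empiricalLaw {n p : ℕ} (x : Fin n → EuclideanSpace ℝ (Fin p)) :
    Measure (EuclideanSpace ℝ (Fin p)) :=
  (n : ℝ≥0∞)⁻¹ • ∑ j, Measure.dirac (x j)

end

/-! Let `c` be any coupling of `F` and `F̂`. The contrasts of `n` independent pairs drawn from `c`
couple the two contrast laws. Each coordinate of their difference combines iid differences with
coefficients summing to zero, so its mean vanishes and its second moment is a variance, at most `δ²`
times the second moment of one difference. The squared distance is thus at most a constant times the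
cost of `c`, whatever `n` (`wasserstein₂_contrastLaw_le`).

It remains to couple `F` and `F̂` cheaply, uniformly over `Δ₀`. Cut the space into finitely many
cells, small inside a ball of radius `R`, and match the mass common to both laws cell by cell. The
cost is a squared diameter, plus `4R²` times the total shortfall of the cell frequencies, plus tails
of second moments (`exists_coupling_of_partition`). Compactness makes the tails uniformly small
(`exists_lintegral_tailSq_le`), and the empirical tail has the same expectation as the true one. A
variance bound makes the mean shortfall vanish at a rate free of `F`
(`lintegral_sub_empiricalLaw_le`). Markov's inequality concludes. -/

/-! ### Couplings built from a finite partition. -/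

section PartitionCoupling

variable {E ι : Type*} [MeasurableSpace E] [Fintype ι]

lemma map_finset_sum_measure {E' : Type*} [MeasurableSpace E'] {f : E → E'} (hf : Measurable f)
    (μ : ι → Measure E) : (∑ i, μ i).map f = ∑ i, (μ i).map f := by
  ext s hs
  simp [Measure.map_apply hf hs, Measure.coe_finsetSum]

/-- The part of the mass of a measure that exceeds the weights `m` on the cells of a partition. -/
noncomputable def excessMeasure (μ : Measure E) (A : ι → Set E) (m : ι → ℝ≥0∞) : Measure E :=
  ∑ i, (μ (A i) - m i) • μ[|A i]

/-- The coupling of two probability measures that, on each cell of a partition, couples the common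
mass independently, and couples the remaining masses independently. -/
noncomputable def partitionCoupling (μ ν : Measure E) (A : ι → Set E) : Measure (E × E) :=
  (∑ i, min (μ (A i)) (ν (A i)) • (μ[|A i]).prod (ν[|A i])) +
    (∑ i, (μ (A i) - min (μ (A i)) (ν (A i))))⁻¹ •
      (excessMeasure μ A fun i => min (μ (A i)) (ν (A i))).prod
        (excessMeasure ν A fun i => min (μ (A i)) (ν (A i)))

instance (μ : Measure E) (A : ι → Set E) (m : ι → ℝ≥0∞) [IsFiniteMeasure μ] :
    IsFiniteMeasure (excessMeasure μ A m) := by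
  constructor
  simp only [excessMeasure, Measure.coe_finsetSum, Finset.sum_apply, Measure.smul_apply,
    smul_eq_mul]
  refine ENNReal.sum_lt_top.2 fun i _ => ENNReal.mul_lt_top ?_ (measure_lt_top _ _)
  exact (tsub_le_self).trans_lt (measure_lt_top _ _)

lemma excessMeasure_univ (μ : Measure E) [IsFiniteMeasure μ] (A : ι → Set E) (m : ι → ℝ≥0∞) :
    excessMeasure μ A m Set.univ = ∑ i, (μ (A i) - m i) := by
  simp only [excessMeasure, Measure.coe_finsetSum, Finset.sum_apply, Measure.smul_apply,
    smul_eq_mul]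
  refine Finset.sum_congr rfl fun i _ => ?_
  by_cases h : μ (A i) = 0
  · simp [h]
  · have := cond_isProbabilityMeasure (μ := μ) h
    simp

lemma sum_smul_cond_add_excessMeasure [MeasurableSpace ι] [MeasurableSingletonClass ι]
    (μ : Measure E) [IsFiniteMeasure μ] {q : E → ι} (hq : Measurable q) {m : ι → ℝ≥0∞}
    (hm : ∀ i, m i ≤ μ (q ⁻¹' {i})) :
    (∑ i, m i • μ[|q ⁻¹' {i}]) + excessMeasure μ (fun i => q ⁻¹' {i}) m = μ := by
  rw [excessMeasure, ← Finset.sum_add_distrib]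
  simp_rw [← add_smul, fun i => add_tsub_cancel_of_le (hm i)]
  exact sum_meas_smul_cond_fiber hq μ

lemma mul_cond_univ (μ : Measure E) [IsFiniteMeasure μ] (s : Set E) {a : ℝ≥0∞}
    (ha : a ≤ μ s) : a * μ[|s] Set.univ = a := by
  by_cases h : μ s = 0
  · simp [le_antisymm (h ▸ ha) zero_le]
  · have := cond_isProbabilityMeasure (μ := μ) h
    simp

variable [MeasurableSpace ι] [MeasurableSingletonClass ι]

lemma sum_measure_fiber (μ : Measure E) {q : E → ι} (hq : Measurable q) :
    ∑ i, μ (q ⁻¹' {i}) = μ Set.univ := by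
  rw [sum_measure_preimage_singleton _ fun i _ => hq (measurableSet_singleton i)]
  simp

/-- Both sides complete the finite common mass `∑ i, m i` to 1. Equality lets one normalisation
`r⁻¹` serve both marginals. -/
lemma sum_excess_eq (μ ν : Measure E) [IsProbabilityMeasure μ] [IsProbabilityMeasure ν]
    {q : E → ι} (hq : Measurable q) :
    ∑ i, (ν (q ⁻¹' {i}) - min (μ (q ⁻¹' {i})) (ν (q ⁻¹' {i}))) =
      ∑ i, (μ (q ⁻¹' {i}) - min (μ (q ⁻¹' {i})) (ν (q ⁻¹' {i}))) := by
  set m : ι → ℝ≥0∞ := fun i => min (μ (q ⁻¹' {i})) (ν (q ⁻¹' {i})) with hm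
  have hfin : ∑ i, m i ≠ ∞ := by
    refine ne_top_of_le_ne_top ENNReal.one_ne_top
      ((Finset.sum_le_sum fun i _ => min_le_left _ _).trans ?_)
    rw [sum_measure_fiber μ hq, measure_univ]
  have key : ∀ ρ : Measure E, IsProbabilityMeasure ρ → (∀ i, m i ≤ ρ (q ⁻¹' {i})) →
      (∑ i, (ρ (q ⁻¹' {i}) - m i)) + ∑ i, m i = 1 := by
    intro ρ _ h
    rw [← Finset.sum_add_distrib]
    simp_rw [fun i => tsub_add_cancel_of_le (h i)]
    rw [sum_measure_fiber ρ hq, measure_univ]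
  exact (ENNReal.add_left_inj hfin).1
    ((key ν inferInstance fun i => min_le_right _ _).trans
      (key μ inferInstance fun i => min_le_left _ _).symm)

/-- Covers the degenerate case of no excess mass, where `r⁻¹ = ∞` but the measure itself is zero. -/
lemma inv_mul_smul_of_univ_eq {μ : Measure E} {r : ℝ≥0∞} (h : μ Set.univ = r) (hr : r ≠ ∞) :
    (r⁻¹ * r) • μ = μ := by
  by_cases h0 : r = 0
  · have : μ = 0 := Measure.measure_univ_eq_zero.1 (h.trans h0)
    simp [this]
  · rw [ENNReal.inv_mul_cancel h0 hr, one_smul]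

lemma map_fst_partitionCoupling (μ ν : Measure E) [IsProbabilityMeasure μ]
    [IsProbabilityMeasure ν] {q : E → ι} (hq : Measurable q) :
    (partitionCoupling μ ν fun i => q ⁻¹' {i}).map Prod.fst = μ := by
  have hr := excessMeasure_univ μ (fun i => q ⁻¹' {i})
    fun i => min (μ (q ⁻¹' {i})) (ν (q ⁻¹' {i}))
  have hr' := (excessMeasure_univ ν (fun i => q ⁻¹' {i})
    fun i => min (μ (q ⁻¹' {i})) (ν (q ⁻¹' {i}))).trans (sum_excess_eq μ ν hq)
  rw [partitionCoupling, Measure.map_add _ _ measurable_fst, Measure.map_smul,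
    map_finset_sum_measure measurable_fst]
  simp_rw [Measure.map_smul, Measure.map_fst_prod, hr', smul_smul,
    mul_cond_univ ν _ (min_le_right _ _)]
  rw [inv_mul_smul_of_univ_eq hr (hr ▸ measure_ne_top _ _)]
  exact sum_smul_cond_add_excessMeasure μ hq fun i => min_le_left _ _

lemma map_snd_partitionCoupling (μ ν : Measure E) [IsProbabilityMeasure μ]
    [IsProbabilityMeasure ν] {q : E → ι} (hq : Measurable q) :
    (partitionCoupling μ ν fun i => q ⁻¹' {i}).map Prod.snd = ν := by
  have hr := excessMeasure_univ μ (fun i => q ⁻¹' {i})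
    fun i => min (μ (q ⁻¹' {i})) (ν (q ⁻¹' {i}))
  have hr' := (excessMeasure_univ ν (fun i => q ⁻¹' {i})
    fun i => min (μ (q ⁻¹' {i})) (ν (q ⁻¹' {i}))).trans (sum_excess_eq μ ν hq)
  rw [partitionCoupling, Measure.map_add _ _ measurable_snd, Measure.map_smul,
    map_finset_sum_measure measurable_snd]
  simp_rw [Measure.map_smul, Measure.map_snd_prod, hr, smul_smul,
    mul_cond_univ μ _ (min_le_left _ _)]
  rw [inv_mul_smul_of_univ_eq hr' (hr ▸ measure_ne_top _ _)]
  exact sum_smul_cond_add_excessMeasure ν hq fun i => min_le_right _ _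

/-- Two probability measures can be coupled at a cost that is controlled by the difference of the
masses they give to the cells of a finite partition. -/
theorem exists_coupling_of_partition (μ ν : Measure E) [IsProbabilityMeasure μ]
    [IsProbabilityMeasure ν] {q : E → ι} (hq : Measurable q) {cost : E × E → ℝ≥0∞}
    {h : E → ℝ≥0∞} (hh : Measurable h) {a b : ℝ≥0∞}
    (hdiag : ∀ x y, q x = q y → cost (x, y) ≤ a + (h x + h y))
    (hall : ∀ x y, cost (x, y) ≤ b + (h x + h y)) :
    ∃ c : Measure (E × E), c.map Prod.fst = μ ∧ c.map Prod.snd = ν ∧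
      ∫⁻ z, cost z ∂c ≤
        a + b * ∑ i, (μ (q ⁻¹' {i}) - ν (q ⁻¹' {i})) + (∫⁻ x, h x ∂μ + ∫⁻ x, h x ∂ν) := by
  refine ⟨_, map_fst_partitionCoupling μ ν hq, map_snd_partitionCoupling μ ν hq, ?_⟩
  have hfst := map_fst_partitionCoupling μ ν hq
  have hsnd := map_snd_partitionCoupling μ ν hq
  have hr := excessMeasure_univ μ (fun i => q ⁻¹' {i})
    fun i => min (μ (q ⁻¹' {i})) (ν (q ⁻¹' {i}))
  have hr' := (excessMeasure_univ ν (fun i => q ⁻¹' {i})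
    fun i => min (μ (q ⁻¹' {i})) (ν (q ⁻¹' {i}))).trans (sum_excess_eq μ ν hq)
  set c := partitionCoupling μ ν fun i => q ⁻¹' {i} with hc
  rw [partitionCoupling] at hc
  set c₁ := ∑ i, min (μ (q ⁻¹' {i})) (ν (q ⁻¹' {i})) •
    (μ[|q ⁻¹' {i}]).prod (ν[|q ⁻¹' {i}]) with hc₁
  set r := ∑ i, (μ (q ⁻¹' {i}) - min (μ (q ⁻¹' {i})) (ν (q ⁻¹' {i}))) with hrdef
  set c₂ := r⁻¹ • (excessMeasure μ (fun i => q ⁻¹' {i})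
      fun i => min (μ (q ⁻¹' {i})) (ν (q ⁻¹' {i}))).prod
    (excessMeasure ν (fun i => q ⁻¹' {i})
      fun i => min (μ (q ⁻¹' {i})) (ν (q ⁻¹' {i}))) with hc₂
  have hcu : c Set.univ = 1 := by
    rw [← measure_univ (μ := μ), ← hfst, Measure.map_apply measurable_fst .univ, Set.preimage_univ]
  have hc₁u : c₁ Set.univ ≤ 1 := by
    rw [← hcu, hc]; simp
  have hc₂u : c₂ Set.univ ≤ r := by
    rw [hc₂, Measure.smul_apply, ← Set.univ_prod_univ, Measure.prod_prod, hr, hr', smul_eq_mul,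
      ← mul_assoc]
    exact mul_le_of_le_one_left' (ENNReal.inv_mul_le_one _)
  have hrle : r = ∑ i, (μ (q ⁻¹' {i}) - ν (q ⁻¹' {i})) :=
    Finset.sum_congr rfl fun i _ => by rw [tsub_min]
  have hpair : Measurable fun z : E × E => h z.1 + h z.2 := by fun_prop
  -- Almost surely under each summand of `c₁` both points lie in the same cell, so `hdiag` applies.
  have h₁ : ∫⁻ z, cost z ∂c₁ ≤ ∫⁻ z, (a + (h z.1 + h z.2)) ∂c₁ := by
    rw [hc₁, lintegral_finsetSum_measure, lintegral_finsetSum_measure]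
    refine Finset.sum_le_sum fun i _ => ?_
    rw [lintegral_smul_measure, lintegral_smul_measure, smul_eq_mul, smul_eq_mul]
    refine mul_le_mul_right (lintegral_mono_ae ?_) _
    have hA : MeasurableSet (q ⁻¹' {i}) := hq (measurableSet_singleton i)
    have e₁ := Measure.quasiMeasurePreserving_fst (μ := μ[|q ⁻¹' {i}]) (ν := ν[|q ⁻¹' {i}])
      |>.ae (ae_cond_mem hA)
    have e₂ := Measure.quasiMeasurePreserving_snd (μ := μ[|q ⁻¹' {i}]) (ν := ν[|q ⁻¹' {i}])
      |>.ae (ae_cond_mem hA)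
    filter_upwards [e₁, e₂] with z hz₁ hz₂
    exact hdiag _ _ (hz₁.trans hz₂.symm)
  have h₂ : ∫⁻ z, cost z ∂c₂ ≤ ∫⁻ z, (b + (h z.1 + h z.2)) ∂c₂ :=
    lintegral_mono fun z => hall _ _
  have h₃ : ∫⁻ z, (h z.1 + h z.2) ∂c = ∫⁻ x, h x ∂μ + ∫⁻ x, h x ∂ν := by
    rw [lintegral_add_left (by fun_prop)]
    conv_rhs => rw [← hfst, ← hsnd, lintegral_map hh measurable_fst, lintegral_map hh measurable_snd]
  calc ∫⁻ z, cost z ∂c = ∫⁻ z, cost z ∂c₁ + ∫⁻ z, cost z ∂c₂ := by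
        rw [hc, lintegral_add_measure]
    _ ≤ ∫⁻ z, (a + (h z.1 + h z.2)) ∂c₁ + ∫⁻ z, (b + (h z.1 + h z.2)) ∂c₂ := add_le_add h₁ h₂
    _ = a * c₁ Set.univ + b * c₂ Set.univ + ∫⁻ z, (h z.1 + h z.2) ∂c := by
        rw [lintegral_add_left measurable_const, lintegral_add_left measurable_const,
          lintegral_const, lintegral_const, hc, lintegral_add_measure]
        ring
    _ ≤ _ := by
        rw [h₃, ← hrle]
        gcongr
        exact mul_le_of_le_one_right' hc₁u

end PartitionCoupling

/-! ### Finite partitions with small cells in a ball. -/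

section Partition

/-- There is a simple function whose level sets have small diameter within a given ball. -/
theorem exists_simpleFunc_dist_le {E : Type*} [NormedAddCommGroup E] [ProperSpace E]
    [MeasurableSpace E] [OpensMeasurableSpace E] (R : ℝ) {η : ℝ} (hη : 0 < η) :
    ∃ f : SimpleFunc E E, ∀ x y, ‖x‖ ≤ R → ‖y‖ ≤ R → f x = f y → ‖x - y‖ ≤ η := by
  let e : ℕ → E := TopologicalSpace.denseSeq E
  have hcover : Metric.closedBall (0 : E) R ⊆ ⋃ k, Metric.ball (e k) (η / 2) := by
    intro x _
    obtain ⟨k, hk⟩ := (TopologicalSpace.denseRange_denseSeq E).exists_dist_lt x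
      (half_pos hη)
    exact Set.mem_iUnion.2 ⟨k, hk⟩
  obtain ⟨t, ht⟩ := (isCompact_closedBall (0 : E) R).elim_finite_subcover _
    (fun k => Metric.isOpen_ball) hcover
  -- The centres `e 0, …, e (t.sup id)` include those of the finite subcover; points with a common
  -- nearest centre are within `η / 2 + η / 2`.
  refine ⟨SimpleFunc.nearestPt e (t.sup id), ?_⟩
  have key : ∀ x, ‖x‖ ≤ R → dist (SimpleFunc.nearestPt e (t.sup id) x) x ≤ η / 2 := by
    intro x hx
    obtain ⟨k, hk, hxk⟩ := Set.mem_iUnion₂.1 (ht (mem_closedBall_zero_iff.2 hx))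
    have h := SimpleFunc.edist_nearestPt_le e x (Finset.le_sup (f := id) hk)
    rw [id, edist_dist, edist_dist, ENNReal.ofReal_le_ofReal_iff dist_nonneg] at h
    exact h.trans (by rw [dist_comm]; exact (Metric.mem_ball.1 hxk).le)
  intro x y hx hy hxy
  rw [← dist_eq_norm]
  have h1 := key x hx
  have h2 := key y hy
  rw [← hxy] at h2
  linarith [dist_triangle_left x y (SimpleFunc.nearestPt e (t.sup id) x)]

end Partition

/-! ### Contrasts of independent rows and the Wasserstein distance. -/

section Contrast

variable {n p : ℕ}

lemma measurable_columnContrasts (M : Matrix (Fin n) (Fin p) ℝ) :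
    Measurable (columnContrasts M) := by
  unfold columnContrasts
  fun_prop

lemma enorm_sq_eq_sum (x : EuclideanSpace ℝ (Fin p)) :
    ‖x‖ₑ ^ 2 = ∑ k, ‖x k‖ₑ ^ 2 := by
  simp_rw [← ofReal_norm, ← ENNReal.ofReal_pow (norm_nonneg _)]
  rw [EuclideanSpace.norm_sq_eq, ENNReal.ofReal_sum_of_nonneg fun _ _ => by positivity]

/-- A linear combination of independent copies of a square-integrable random variable whose
coefficients sum to zero has second moment at most the sum of squares of the coefficients times
that of the variable. -/
theorem lintegral_sq_sum_mul_le {S : Type*} [MeasurableSpace S] (c : Measure S)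
    [IsProbabilityMeasure c] {D : S → ℝ} (hD : MemLp D 2 c) {m : Fin n → ℝ}
    (hm : ∑ j, m j = 0) :
    ∫⁻ z, ‖∑ j, m j * D (z j)‖ₑ ^ 2 ∂(Measure.pi fun _ : Fin n => c) ≤
      ENNReal.ofReal (∑ j, m j ^ 2) * ∫⁻ s, ‖D s‖ₑ ^ 2 ∂c := by
  set π := Measure.pi fun _ : Fin n => c
  have hmem : ∀ j, MemLp (fun s => m j * D s) 2 c := fun j => hD.const_mul (m j)
  have hmem' : ∀ j, MemLp (fun z : Fin n → S => m j * D (z j)) 2 π := fun j =>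
    (hmem j).comp_measurePreserving (measurePreserving_eval _ j)
  have hvar := variance_sum_pi (μ := fun _ : Fin n => c) (X := fun j s => m j * D s) hmem
  have hsum : MemLp (∑ j, fun z : Fin n → S => m j * D (z j)) 2 π :=
    memLp_finsetSum' _ fun j _ => hmem' j
  have hmean : π[∑ j, fun z : Fin n → S => m j * D (z j)] = 0 := by
    simp_rw [Finset.sum_apply]
    rw [integral_finsetSum _ fun j _ => (hmem' j).integrable one_le_two]
    have : ∀ j, ∫ z, m j * D (z j) ∂π = m j * ∫ s, D s ∂c := fun j => by
      rw [integral_const_mul]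
      congr 1
      exact integral_comp_eval (μ := fun _ : Fin n => c) (f := D) hD.aestronglyMeasurable
    simp_rw [this, ← Finset.sum_mul, hm, zero_mul]
  have hlhs : ∫⁻ z, ‖∑ j, m j * D (z j)‖ₑ ^ 2 ∂π =
      ENNReal.ofReal (Var[∑ j, fun z : Fin n → S => m j * D (z j); π]) := by
    rw [ofReal_variance hsum, evariance, hmean]
    simp
  have hD2 : ENNReal.ofReal (Var[D; c]) ≤ ∫⁻ s, ‖D s‖ₑ ^ 2 ∂c := by
    calc ENNReal.ofReal (Var[D; c]) ≤ ENNReal.ofReal (∫ s, (D ^ 2) s ∂c) :=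
          ENNReal.ofReal_le_ofReal (variance_le_expectation_sq hD.aestronglyMeasurable)
      _ = ∫⁻ s, ‖D s‖ₑ ^ 2 ∂c := by
          simp_rw [Pi.pow_apply]
          rw [ofReal_integral_eq_lintegral_ofReal hD.integrable_sq
            (ae_of_all _ fun s => sq_nonneg _)]
          refine lintegral_congr fun s => ?_
          rw [← ofReal_norm, ← ENNReal.ofReal_pow (norm_nonneg _), Real.norm_eq_abs, sq_abs]
  rw [hlhs, hvar]
  simp_rw [variance_const_mul, ← Finset.sum_mul]
  rw [ENNReal.ofReal_mul (by positivity)]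
  gcongr

lemma map_columnContrasts_pi {S : Type*} [MeasurableSpace S] (M : Matrix (Fin n) (Fin p) ℝ)
    (c : Measure S) [IsProbabilityMeasure c] {f : S → EuclideanSpace ℝ (Fin p)}
    (hf : Measurable f) :
    (Measure.pi fun _ : Fin n => c).map (fun z => columnContrasts M fun j => f (z j)) =
      contrastLaw M (c.map f) := by
  have := Measure.isProbabilityMeasure_map (μ := c) hf.aemeasurable
  rw [contrastLaw, ← Measure.pi_map_pi (fun _ => hf.aemeasurable),
    Measure.map_map (measurable_columnContrasts M) (by fun_prop)]
  rfl

/-- The Wasserstein distance of the laws of column contrasts is controlled by the cost of any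
coupling of the laws of the rows. -/
theorem wasserstein₂_contrastLaw_le (M : Matrix (Fin n) (Fin p) ℝ) {δ : ℝ}
    (hM : ∀ k, ∑ j, M j k = 0) (hM' : ∀ k, ∑ j, M j k ^ 2 ≤ δ ^ 2)
    {μ ν : Measure (EuclideanSpace ℝ (Fin p))} [IsProbabilityMeasure μ]
    (c : Measure (EuclideanSpace ℝ (Fin p) × EuclideanSpace ℝ (Fin p)))
    (hfst : c.map Prod.fst = μ) (hsnd : c.map Prod.snd = ν) :
    wasserstein₂ (contrastLaw M μ) (contrastLaw M ν) ≤
      (ENNReal.ofReal (δ ^ 2 + 1) * ∫⁻ z, ‖z.1 - z.2‖ₑ ^ 2 ∂c) ^ (1 / 2 : ℝ) := by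
  have hc : IsProbabilityMeasure c := by
    constructor
    rw [← measure_univ (μ := μ), ← hfst, Measure.map_apply measurable_fst .univ, Set.preimage_univ]
  -- The nonzero factor `δ ^ 2 + 1` makes the right side infinite here even if `δ = 0`, where `0 * ∞
  -- = 0` would spoil the bound.
  by_cases hcost : ∫⁻ z, ‖z.1 - z.2‖ₑ ^ 2 ∂c = ∞
  · rw [hcost, ENNReal.mul_top (by simp; positivity)]
    simp
  refine ENNReal.rpow_le_rpow ?_ (by norm_num)
  set T : (Fin n → EuclideanSpace ℝ (Fin p) × EuclideanSpace ℝ (Fin p)) →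
      EuclideanSpace ℝ (Fin p) × EuclideanSpace ℝ (Fin p) :=
    fun z => (columnContrasts M fun j => (z j).1, columnContrasts M fun j => (z j).2) with hT
  have hTm : Measurable T := by
    have := measurable_columnContrasts M
    fun_prop
  have hT₁ : ((Measure.pi fun _ : Fin n => c).map T).map Prod.fst = contrastLaw M μ := by
    rw [Measure.map_map measurable_fst hTm, ← hfst]
    exact map_columnContrasts_pi M c measurable_fst
  have hT₂ : ((Measure.pi fun _ : Fin n => c).map T).map Prod.snd = contrastLaw M ν := by
    rw [Measure.map_map measurable_snd hTm, ← hsnd]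
    exact map_columnContrasts_pi M c measurable_snd
  refine (iInf₂_le ((Measure.pi fun _ : Fin n => c).map T) ⟨hT₁, hT₂⟩).trans ?_
  rw [lintegral_map (by fun_prop) hTm]
  have hcoord : ∀ z k, ((T z).1 - (T z).2) k = ∑ j, M j k * ((z j).1 k - (z j).2 k) := by
    intro z k
    simp [hT, columnContrasts, mul_sub]
  have hDmeas : ∀ k, Measurable fun z : EuclideanSpace ℝ (Fin p) × EuclideanSpace ℝ (Fin p) =>
      z.1 k - z.2 k := fun k => by fun_prop
  have hDsum : ∫⁻ z, ‖z.1 - z.2‖ₑ ^ 2 ∂c = ∑ k, ∫⁻ z, ‖z.1 k - z.2 k‖ₑ ^ 2 ∂c := by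
    simp_rw [enorm_sq_eq_sum, PiLp.sub_apply]
    exact lintegral_finsetSum _ fun k _ => (hDmeas k).enorm.pow_const 2
  have hD : ∀ k, MemLp (fun z : EuclideanSpace ℝ (Fin p) × EuclideanSpace ℝ (Fin p) =>
      z.1 k - z.2 k) 2 c := by
    intro k
    refine ⟨(hDmeas k).aestronglyMeasurable, ?_⟩
    rw [eLpNorm_lt_top_iff_lintegral_rpow_enorm_lt_top two_ne_zero ENNReal.ofNat_ne_top]
    simp only [ENNReal.toReal_ofNat, ENNReal.rpow_ofNat]
    rw [hDsum] at hcost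
    exact lt_top_iff_ne_top.2 fun h => hcost (ENNReal.sum_eq_top.2 ⟨k, Finset.mem_univ k, h⟩)
  simp_rw [enorm_sq_eq_sum, hcoord]
  rw [lintegral_finsetSum _ fun k _ => Measurable.pow_const (Measurable.enorm (by fun_prop)) 2]
  simp_rw [← PiLp.sub_apply, ← enorm_sq_eq_sum]
  rw [hDsum, Finset.mul_sum]
  refine Finset.sum_le_sum fun k _ => ?_
  refine (lintegral_sq_sum_mul_le c (hD k) (hM k)).trans ?_
  gcongr
  linarith [hM' k]

end Contrast

/-! ### Uniform integrability from compactness. -/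

section UniformIntegrability

variable {p : ℕ}

/-- The squared norm, cut off to the complement of the closed ball of radius `R`. -/
noncomputable def tailSq {E : Type*} [Norm E] (R : ℝ) (x : E) : ℝ := if R < ‖x‖ then ‖x‖ ^ 2 else 0

lemma tailSq_nonneg {E : Type*} [Norm E] (R : ℝ) (x : E) : 0 ≤ tailSq R x := by
  unfold tailSq; split_ifs <;> positivity

@[fun_prop]
lemma measurable_tailSq {E : Type*} [NormedAddCommGroup E] [MeasurableSpace E]
    [OpensMeasurableSpace E] (R : ℝ) : Measurable (tailSq R : E → ℝ) :=
  Measurable.ite (measurableSet_lt measurable_const measurable_norm) (by fun_prop)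
    measurable_const

lemma FiniteVarianceLaw.integrable_norm_sq (F : FiniteVarianceLaw p) :
    Integrable (fun x => ‖x‖ ^ 2) F.law := by
  refine ⟨by fun_prop, ?_⟩
  simpa [HasFiniteIntegral, enorm_pow] using F.lintegral_sq_lt_top

/-- A continuous majorant of `tailSq k` of quadratic growth. -/
noncomputable def tailMajorant (p k : ℕ) : QuadraticGrowthFun p :=
  ⟨fun x => max (2 * ‖x‖ ^ 2 - (k : ℝ) ^ 2) 0, by fun_prop, 2, fun x => by
    have h0 : 0 ≤ max (2 * ‖x‖ ^ 2 - (k : ℝ) ^ 2) 0 := le_max_right _ _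
    rw [abs_of_nonneg (by positivity), div_le_iff₀ (by positivity)]
    exact max_le (by nlinarith [sq_nonneg (k : ℝ)]) (by positivity)⟩

lemma tailMajorant_nonneg (k : ℕ) (x : EuclideanSpace ℝ (Fin p)) : 0 ≤ (tailMajorant p k).1 x :=
  le_max_right _ _

lemma tailMajorant_le (k : ℕ) (x : EuclideanSpace ℝ (Fin p)) :
    (tailMajorant p k).1 x ≤ 2 * ‖x‖ ^ 2 :=
  max_le (by nlinarith [sq_nonneg (k : ℝ)]) (by positivity)

lemma tailMajorant_antitone (x : EuclideanSpace ℝ (Fin p)) :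
    Antitone fun k => (tailMajorant p k).1 x := by
  intro k l h
  simp only [tailMajorant]
  gcongr

/-- The indicator cut-off is discontinuous, hence no test function for the topology; this continuous
majorant is one. -/
lemma tailSq_le_tailMajorant (k : ℕ) (x : EuclideanSpace ℝ (Fin p)) :
    tailSq (k : ℝ) x ≤ (tailMajorant p k).1 x := by
  simp only [tailSq, tailMajorant]
  split_ifs with h
  · refine le_max_of_le_left ?_
    have : (k : ℝ) ^ 2 ≤ ‖x‖ ^ 2 := by gcongr
    linarith
  · exact le_max_right _ _

lemma FiniteVarianceLaw.integrable_tailMajorant (F : FiniteVarianceLaw p) (k : ℕ) :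
    Integrable (tailMajorant p k).1 F.law := by
  refine (F.integrable_norm_sq.const_mul 2).mono'
    (tailMajorant p k).2.1.aestronglyMeasurable (ae_of_all _ fun x => ?_)
  rw [Real.norm_of_nonneg (tailMajorant_nonneg k x)]
  exact tailMajorant_le k x

lemma FiniteVarianceLaw.tendsto_integral_tailMajorant (F : FiniteVarianceLaw p) :
    Tendsto (fun k => ∫ x, (tailMajorant p k).1 x ∂F.law) atTop (𝓝 0) := by
  have h := tendsto_integral_of_dominated_convergence (μ := F.law)
    (F := fun k => (tailMajorant p k).1) (f := fun _ => 0) (fun x => 2 * ‖x‖ ^ 2)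
    (fun k => (tailMajorant p k).2.1.aestronglyMeasurable) (F.integrable_norm_sq.const_mul 2)
    (fun k => ae_of_all _ fun x => by
      rw [Real.norm_of_nonneg (tailMajorant_nonneg k x)]
      exact tailMajorant_le k x)
    (ae_of_all _ fun x => by
      obtain ⟨N, hN⟩ := exists_nat_ge (2 * ‖x‖)
      refine tendsto_const_nhds.congr' ?_
      filter_upwards [eventually_ge_atTop N] with k hk
      have : 2 * ‖x‖ ≤ k := hN.trans (by exact_mod_cast hk)
      refine (max_eq_right ?_).symm
      nlinarith [norm_nonneg x])
  simpa using h

/-- On a compact set of laws the second moments are uniformly integrable. -/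
theorem exists_lintegral_tailSq_le {Δ₀ : Set (FiniteVarianceLaw p)} (hΔ₀ : IsCompact Δ₀)
    {τ : ℝ} (hτ : 0 < τ) :
    ∃ R : ℝ, ∀ F ∈ Δ₀, ∫⁻ x, ENNReal.ofReal (tailSq R x) ∂F.law ≤ ENNReal.ofReal τ := by
  have hcont : ∀ γ : QuadraticGrowthFun p,
      Continuous fun F : FiniteVarianceLaw p => ∫ x, γ.1 x ∂F.law := by
    intro γ
    have h : Continuous fun (F : FiniteVarianceLaw p) (γ : QuadraticGrowthFun p) =>
      ∫ x, γ.1 x ∂F.law := continuous_induced_dom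
    exact (continuous_apply γ).comp h
  obtain ⟨t, ht⟩ := hΔ₀.elim_finite_subcover
    (fun k : ℕ => {F : FiniteVarianceLaw p | ∫ x, (tailMajorant p k).1 x ∂F.law < τ})
    (fun k => isOpen_lt (hcont _) continuous_const)
    (fun F _ => Set.mem_iUnion.2
      (F.tendsto_integral_tailMajorant.eventually (gt_mem_nhds hτ)).exists)
  -- The majorants decrease in `k`, so the largest index of the subcover serves every `F`.
  refine ⟨(t.sup id : ℕ), fun F hF => ?_⟩
  obtain ⟨k, hk, hkF⟩ := Set.mem_iUnion₂.1 (ht hF)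
  have hmaj : ∀ x, tailSq ((t.sup id : ℕ) : ℝ) x ≤ (tailMajorant p k).1 x := fun x =>
    (tailSq_le_tailMajorant _ x).trans (tailMajorant_antitone x (Finset.le_sup (f := id) hk))
  calc ∫⁻ x, ENNReal.ofReal (tailSq ((t.sup id : ℕ) : ℝ) x) ∂F.law
      ≤ ∫⁻ x, ENNReal.ofReal ((tailMajorant p k).1 x) ∂F.law :=
        lintegral_mono fun x => ENNReal.ofReal_le_ofReal (hmaj x)
    _ = ENNReal.ofReal (∫ x, (tailMajorant p k).1 x ∂F.law) :=
        (ofReal_integral_eq_lintegral_ofReal (F.integrable_tailMajorant k)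
          (ae_of_all _ fun x => tailMajorant_nonneg k x)).symm
    _ ≤ ENNReal.ofReal τ := ENNReal.ofReal_le_ofReal (le_of_lt hkF)

end UniformIntegrability

/-! ### Moments of the empirical law. -/

section Empirical

variable {n p : ℕ}

lemma lintegral_empiricalLaw (x : Fin n → EuclideanSpace ℝ (Fin p))
    {h : EuclideanSpace ℝ (Fin p) → ℝ≥0∞} (hh : Measurable h) :
    ∫⁻ y, h y ∂empiricalLaw x = (n : ℝ≥0∞)⁻¹ * ∑ j, h (x j) := by
  rw [empiricalLaw, lintegral_smul_measure, lintegral_finsetSum_measure, smul_eq_mul]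
  simp_rw [lintegral_dirac' _ hh]

lemma isProbabilityMeasure_empiricalLaw (hn : n ≠ 0) (x : Fin n → EuclideanSpace ℝ (Fin p)) :
    IsProbabilityMeasure (empiricalLaw x) := by
  constructor
  simp [empiricalLaw, ENNReal.inv_mul_cancel, hn]

variable {Ω : Type*} [MeasurableSpace Ω] {P : Measure Ω}
  {μ : Measure (EuclideanSpace ℝ (Fin p))} {X : Fin n → Ω → EuclideanSpace ℝ (Fin p)}

lemma aemeasurable_lintegral_empiricalLaw (hX : ∀ j, AEMeasurable (X j) P)
    {h : EuclideanSpace ℝ (Fin p) → ℝ≥0∞} (hh : Measurable h) :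
    AEMeasurable (fun ω => ∫⁻ y, h y ∂empiricalLaw fun j => X j ω) P := by
  simp_rw [lintegral_empiricalLaw _ hh]
  exact (Finset.aemeasurable_fun_sum _ fun j _ => hh.comp_aemeasurable (hX j)).const_mul _

lemma aemeasurable_empiricalLaw_apply (hX : ∀ j, AEMeasurable (X j) P)
    {A : Set (EuclideanSpace ℝ (Fin p))} (hA : MeasurableSet A) :
    AEMeasurable (fun ω => empiricalLaw (fun j => X j ω) A) P := by
  have := aemeasurable_lintegral_empiricalLaw hX (measurable_one.indicator hA)
  simpa only [lintegral_indicator_one hA] using this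

/-- The expectation of an integral with respect to the empirical law is the integral with respect
to the common law of the observations. -/
lemma lintegral_lintegral_empiricalLaw (hn : n ≠ 0) (hX : ∀ j, HasLaw (X j) μ P)
    {h : EuclideanSpace ℝ (Fin p) → ℝ≥0∞} (hh : Measurable h) :
    ∫⁻ ω, ∫⁻ y, h y ∂(empiricalLaw fun j => X j ω) ∂P = ∫⁻ y, h y ∂μ := by
  have hm : ∀ j, AEMeasurable (fun ω => h (X j ω)) P := fun j =>
    hh.comp_aemeasurable (hX j).aemeasurable
  simp_rw [lintegral_empiricalLaw _ hh]
  rw [lintegral_const_mul'' _ (Finset.aemeasurable_fun_sum _ fun j _ => hm j),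
    lintegral_finsetSum' _ fun j _ => hm j]
  have : ∀ j, ∫⁻ ω, h (X j ω) ∂P = ∫⁻ y, h y ∂μ := fun j => by
    rw [← (hX j).map_eq, lintegral_map' hh.aemeasurable (hX j).aemeasurable]
  simp [this, ← mul_assoc, ENNReal.inv_mul_cancel, hn]

/-- The mean shortfall of the empirical frequency of an event is of order `n ^ (-1/2)`. -/
theorem lintegral_sub_empiricalLaw_le [IsProbabilityMeasure P] [IsProbabilityMeasure μ]
    (hn : n ≠ 0) (hX : ∀ j, HasLaw (X j) μ P) (hind : iIndepFun X P)
    {A : Set (EuclideanSpace ℝ (Fin p))} (hA : MeasurableSet A) {t : ℝ} (ht : 0 < t) :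
    ∫⁻ ω, (μ A - empiricalLaw (fun j => X j ω) A) ∂P ≤ ENNReal.ofReal (t + 1 / (n * t)) := by
  have hn' : (0 : ℝ) < n := by positivity
  set g : EuclideanSpace ℝ (Fin p) → ℝ := A.indicator 1 with hg
  have hgm : Measurable g := measurable_one.indicator hA
  have hg01 : ∀ x, g x ∈ Set.Icc (0 : ℝ) 1 := fun x => by
    by_cases hx : x ∈ A <;> simp [hg, hx]
  have hYm : ∀ j, AEStronglyMeasurable (fun ω => g (X j ω)) P := fun j =>
    (hgm.comp_aemeasurable (hX j).aemeasurable).aestronglyMeasurable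
  have hY : ∀ j, MemLp (fun ω => g (X j ω)) 2 P := fun j =>
    MemLp.of_bound (hYm j) 1 (ae_of_all _ fun ω => by
      rw [Real.norm_of_nonneg (hg01 _).1]; exact (hg01 _).2)
  have hYsum : MemLp (∑ j, fun ω => g (X j ω)) 2 P := memLp_finsetSum' _ fun j _ => hY j
  have hYmean : ∀ j, ∫ ω, g (X j ω) ∂P = μ.real A := fun j => by
    rw [← integral_indicator_one hA, ← (hX j).map_eq,
      integral_map (hX j).aemeasurable hgm.aestronglyMeasurable]
  have hvar : Var[∑ j, fun ω => g (X j ω); P] ≤ n := by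
    rw [IndepFun.variance_sum (fun j _ => hY j) fun i _ j _ hij =>
      (hind.indepFun hij).comp hgm hgm]
    calc ∑ j, Var[fun ω => g (X j ω); P] ≤ ∑ _j : Fin n, (1 : ℝ) :=
          Finset.sum_le_sum fun j _ =>
            (variance_le_sq_of_bounded (ae_of_all _ fun ω => hg01 (X j ω))
              (hYm j).aemeasurable).trans (by norm_num)
      _ = n := by simp
  set S : Ω → ℝ := fun ω => ∑ j, g (X j ω) with hS
  have hSsum : (∑ j, fun ω => g (X j ω)) = S := by ext ω; simp [hS]
  rw [hSsum] at hvar hYsum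
  have hSmean : ∫ ω, S ω ∂P = n * μ.real A := by
    rw [hS, integral_finsetSum _ fun j _ => (hY j).integrable one_le_two]
    simp [hYmean]
  have hemp : ∀ ω, empiricalLaw (fun j => X j ω) A = ENNReal.ofReal (S ω / n) := by
    intro ω
    rw [← lintegral_indicator_one hA, lintegral_empiricalLaw _ (measurable_one.indicator hA),
      ENNReal.ofReal_div_of_pos hn', hS, ENNReal.ofReal_sum_of_nonneg fun j _ => (hg01 _).1,
      ENNReal.ofReal_natCast, mul_comm, div_eq_mul_inv]
    congr 2 with j
    by_cases hx : X j ω ∈ A <;> simp [hg, hx]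
  -- With `z = μ.real A - S ω / n` this is `z ≤ t + z ^ 2 / t`, which trades the shortfall for a
  -- variance.
  have hpt : ∀ ω, μ A - empiricalLaw (fun j => X j ω) A ≤
      ENNReal.ofReal t + ENNReal.ofReal (1 / (n ^ 2 * t)) * ‖S ω - ∫ ω, S ω ∂P‖ₑ ^ 2 := by
    intro ω
    rw [hemp, ← ofReal_measureReal, ← ENNReal.ofReal_sub _
      (div_nonneg (Finset.sum_nonneg fun j _ => (hg01 _).1) hn'.le), ← ofReal_norm,
      ← ENNReal.ofReal_pow (norm_nonneg _), ← ENNReal.ofReal_mul (by positivity),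
      ← ENNReal.ofReal_add ht.le (by positivity), hSmean, Real.norm_eq_abs, sq_abs]
    refine ENNReal.ofReal_le_ofReal ?_
    set z := μ.real A - S ω / n with hz
    have e : 1 / ((n : ℝ) ^ 2 * t) * (S ω - n * μ.real A) ^ 2 = z ^ 2 / t := by
      rw [hz]; field_simp; ring
    rw [e, ← sub_nonneg]
    have : t + z ^ 2 / t - z = ((t - z) ^ 2 + t * z) / t := by field_simp; ring
    have h4 : 0 ≤ (t - z) ^ 2 + t * z := by nlinarith [sq_nonneg (t - z), sq_nonneg (t + z)]
    rw [this]; positivity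
  calc ∫⁻ ω, (μ A - empiricalLaw (fun j => X j ω) A) ∂P
      ≤ ∫⁻ ω, (ENNReal.ofReal t +
          ENNReal.ofReal (1 / (n ^ 2 * t)) * ‖S ω - ∫ ω, S ω ∂P‖ₑ ^ 2) ∂P := lintegral_mono hpt
    _ = ENNReal.ofReal t + ENNReal.ofReal (1 / (n ^ 2 * t)) * ENNReal.ofReal (Var[S; P]) := by
        rw [lintegral_add_left measurable_const, lintegral_const, measure_univ, mul_one,
          lintegral_const_mul' _ _ ENNReal.ofReal_ne_top, ofReal_variance hYsum, evariance]
    _ = ENNReal.ofReal (t + 1 / (n ^ 2 * t) * Var[S; P]) := by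
        rw [← ENNReal.ofReal_mul (by positivity), ← ENNReal.ofReal_add ht.le
          (mul_nonneg (by positivity) (variance_nonneg _ _))]
    _ ≤ ENNReal.ofReal (t + 1 / (n * t)) := by
        refine ENNReal.ofReal_le_ofReal ?_
        have : 1 / ((n : ℝ) * t) = 1 / (n ^ 2 * t) * n := by field_simp
        rw [this]
        gcongr

end Empirical

/-! ### Cost bounds and convergence in probability. -/

section Convergence

lemma enorm_sub_sq_le_ofReal_add {E : Type*} [NormedAddCommGroup E] {x y : E} {a h₁ h₂ : ℝ}
    (ha : 0 ≤ a) (hh₁ : 0 ≤ h₁) (hh₂ : 0 ≤ h₂) (h : ‖x - y‖ ^ 2 ≤ a + (h₁ + h₂)) :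
    ‖x - y‖ₑ ^ 2 ≤ ENNReal.ofReal a + (ENNReal.ofReal h₁ + ENNReal.ofReal h₂) := by
  rw [← ofReal_norm, ← ENNReal.ofReal_pow (norm_nonneg _), ← ENNReal.ofReal_add hh₁ hh₂,
    ← ENNReal.ofReal_add ha (add_nonneg hh₁ hh₂)]
  exact ENNReal.ofReal_le_ofReal h

lemma norm_sub_sq_le {E : Type*} [NormedAddCommGroup E] (x y : E) :
    ‖x - y‖ ^ 2 ≤ 2 * ‖x‖ ^ 2 + 2 * ‖y‖ ^ 2 := by
  nlinarith [norm_sub_le x y, norm_nonneg (x - y), sq_nonneg (‖x‖ - ‖y‖), norm_nonneg x,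
    norm_nonneg y]

/-- A tail factor 2 would do; 4 lets the same `h` serve both cost hypotheses of
`exists_coupling_of_partition`. -/
lemma norm_sub_sq_le_add_tailSq {E : Type*} [NormedAddCommGroup E] (R : ℝ) (x y : E) :
    ‖x - y‖ ^ 2 ≤ 4 * R ^ 2 + (4 * tailSq R x + 4 * tailSq R y) := by
  have key : ∀ z : E, ‖z‖ ^ 2 ≤ R ^ 2 + tailSq R z := fun z => by
    unfold tailSq
    split_ifs with h
    · nlinarith
    · have : ‖z‖ ^ 2 ≤ R ^ 2 := by gcongr; exact not_lt.1 h
      linarith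
  linarith [norm_sub_sq_le x y, key x, key y, tailSq_nonneg R x, tailSq_nonneg R y]

/-- If only one point leaves the ball, it has the larger norm, and its tail term alone dominates. -/
lemma norm_sub_sq_le_of_dist_le {E : Type*} [NormedAddCommGroup E] {R η : ℝ} {x y : E} (h : ‖x‖ ≤ R → ‖y‖ ≤ R → ‖x - y‖ ≤ η) :
    ‖x - y‖ ^ 2 ≤ η ^ 2 + (4 * tailSq R x + 4 * tailSq R y) := by
  have hxy := norm_sub_sq_le x y
  have hη := sq_nonneg η
  unfold tailSq
  split_ifs with hx hy hy
  · nlinarith [sq_nonneg ‖x‖, sq_nonneg ‖y‖]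
  · have : ‖y‖ ^ 2 ≤ ‖x‖ ^ 2 := by gcongr; linarith
    linarith
  · have : ‖x‖ ^ 2 ≤ ‖y‖ ^ 2 := by gcongr; linarith
    linarith
  · have : ‖x - y‖ ^ 2 ≤ η ^ 2 := by
      gcongr
      exact h (not_lt.1 hx) (not_lt.1 hy)
    linarith

/-- The probability of a Wasserstein distance of at least `ε` between the laws of the column
contrasts for the true and for the empirical distribution of the rows. -/
theorem measure_wasserstein₂_contrastLaw_ge_le {n p : ℕ} (hn : n ≠ 0) {Ω : Type*}
    [MeasurableSpace Ω] {P : Measure Ω} [IsProbabilityMeasure P]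
    {μ : Measure (EuclideanSpace ℝ (Fin p))} [IsProbabilityMeasure μ]
    {X : Fin n → Ω → EuclideanSpace ℝ (Fin p)} (hX : ∀ j, HasLaw (X j) μ P)
    (hind : iIndepFun X P) (M : Matrix (Fin n) (Fin p) ℝ) {δ : ℝ}
    (hM : ∀ k, ∑ j, M j k = 0) (hM' : ∀ k, ∑ j, M j k ^ 2 ≤ δ ^ 2) {R η τ t ε : ℝ}
    (hτ : 0 ≤ τ) (ht : 0 < t) (hε : 0 < ε)
    (hμ : ∫⁻ x, ENNReal.ofReal (tailSq R x) ∂μ ≤ ENNReal.ofReal τ)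
    (f : SimpleFunc (EuclideanSpace ℝ (Fin p)) (EuclideanSpace ℝ (Fin p)))
    (hf : ∀ x y, ‖x‖ ≤ R → ‖y‖ ≤ R → f x = f y → ‖x - y‖ ≤ η) :
    P {ω | ENNReal.ofReal ε ≤
        wasserstein₂ (contrastLaw M μ) (contrastLaw M (empiricalLaw fun j => X j ω))} ≤
      ENNReal.ofReal ((δ ^ 2 + 1) / ε ^ 2 *
        (η ^ 2 + 4 * R ^ 2 * (f.range.card * (t + 1 / (n * t))) + 8 * τ)) := by
  let q : EuclideanSpace ℝ (Fin p) → f.range := fun x => ⟨f x, f.mem_range_self x⟩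
  have hq : Measurable q := f.measurable.subtype_mk
  have hqA : ∀ i, MeasurableSet (q ⁻¹' {i}) := fun i => hq (measurableSet_singleton i)
  set h : EuclideanSpace ℝ (Fin p) → ℝ≥0∞ := fun x => ENNReal.ofReal (4 * tailSq R x) with hh
  have hhm : Measurable h := by fun_prop
  have hXm : ∀ j, AEMeasurable (X j) P := fun j => (hX j).aemeasurable
  have hhμ : ∫⁻ x, h x ∂μ ≤ ENNReal.ofReal (4 * τ) := by
    simp_rw [hh, ENNReal.ofReal_mul (by norm_num : (0 : ℝ) ≤ 4)]
    rw [lintegral_const_mul' _ _ ENNReal.ofReal_ne_top]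
    gcongr
  -- `B` is an a.e. measurable bound for the cost, so Markov's inequality needs no measurability of
  -- the Wasserstein distance in `ω`.
  set B : Ω → ℝ≥0∞ := fun ω => ENNReal.ofReal (η ^ 2) + ENNReal.ofReal (4 * R ^ 2) *
    ∑ i, (μ (q ⁻¹' {i}) - empiricalLaw (fun j => X j ω) (q ⁻¹' {i})) +
      (∫⁻ x, h x ∂μ + ∫⁻ x, h x ∂empiricalLaw fun j => X j ω) with hB
  have hsub : ∀ i, AEMeasurable
      (fun ω => μ (q ⁻¹' {i}) - empiricalLaw (fun j => X j ω) (q ⁻¹' {i})) P := fun i =>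
    aemeasurable_const.sub (aemeasurable_empiricalLaw_apply hXm (hqA i))
  have hsum : AEMeasurable
      (fun ω => ∑ i, (μ (q ⁻¹' {i}) - empiricalLaw (fun j => X j ω) (q ⁻¹' {i}))) P :=
    Finset.aemeasurable_fun_sum _ fun i _ => hsub i
  have hhemp := aemeasurable_lintegral_empiricalLaw hXm hhm
  have hcell : AEMeasurable (fun ω => ENNReal.ofReal (η ^ 2) + ENNReal.ofReal (4 * R ^ 2) *
      ∑ i, (μ (q ⁻¹' {i}) - empiricalLaw (fun j => X j ω) (q ⁻¹' {i}))) P :=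
    aemeasurable_const.add (hsum.const_mul _)
  have hBm : AEMeasurable B P := hcell.add (aemeasurable_const.add hhemp)
  have hBint : ∫⁻ ω, B ω ∂P ≤ ENNReal.ofReal
      (η ^ 2 + 4 * R ^ 2 * (f.range.card * (t + 1 / (n * t))) + 8 * τ) := by
    have hsplit : ∫⁻ ω, B ω ∂P = ENNReal.ofReal (η ^ 2) + ENNReal.ofReal (4 * R ^ 2) *
        ∑ i, ∫⁻ ω, (μ (q ⁻¹' {i}) - empiricalLaw (fun j => X j ω) (q ⁻¹' {i})) ∂P +
          (∫⁻ x, h x ∂μ + ∫⁻ x, h x ∂μ) := by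
      rw [hB, lintegral_add_left' hcell,
        lintegral_add_left measurable_const, lintegral_add_left measurable_const,
        lintegral_const_mul'' _ hsum, lintegral_finsetSum' _ fun i _ => hsub i,
        lintegral_lintegral_empiricalLaw hn hX hhm]
      simp
    have hcells : ∑ i, ∫⁻ ω, (μ (q ⁻¹' {i}) - empiricalLaw (fun j => X j ω) (q ⁻¹' {i})) ∂P ≤
        ENNReal.ofReal (f.range.card * (t + 1 / (n * t))) := by
      refine (Finset.sum_le_sum fun i _ =>
        lintegral_sub_empiricalLaw_le hn hX hind (hqA i) ht).trans ?_
      rw [Finset.sum_const, nsmul_eq_mul, ENNReal.ofReal_mul (by positivity),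
        ENNReal.ofReal_natCast, Finset.card_univ, Fintype.card_coe]
    rw [hsplit, show (8 : ℝ) * τ = 4 * τ + 4 * τ by ring,
      ENNReal.ofReal_add (by positivity) (by positivity),
      ENNReal.ofReal_add (by positivity) (by positivity),
      ENNReal.ofReal_add (by positivity) (by positivity),
      ENNReal.ofReal_mul (p := 4 * R ^ 2) (by positivity)]
    gcongr
  have hbound : ∀ ω,
      wasserstein₂ (contrastLaw M μ) (contrastLaw M (empiricalLaw fun j => X j ω)) ≤
        (ENNReal.ofReal (δ ^ 2 + 1) * B ω) ^ (1 / 2 : ℝ) := by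
    intro ω
    have := isProbabilityMeasure_empiricalLaw hn fun j => X j ω
    obtain ⟨c, hfst, hsnd, hcost⟩ := exists_coupling_of_partition μ
      (empiricalLaw fun j => X j ω) hq (cost := fun z => ‖z.1 - z.2‖ₑ ^ 2) hhm
      (a := ENNReal.ofReal (η ^ 2)) (b := ENNReal.ofReal (4 * R ^ 2))
      (fun x y hxy => enorm_sub_sq_le_ofReal_add (sq_nonneg η)
        (mul_nonneg (by norm_num) (tailSq_nonneg R x))
        (mul_nonneg (by norm_num) (tailSq_nonneg R y))
        (norm_sub_sq_le_of_dist_le fun hx hy => hf x y hx hy (congrArg Subtype.val hxy)))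
      (fun x y => enorm_sub_sq_le_ofReal_add (by positivity)
        (mul_nonneg (by norm_num) (tailSq_nonneg R x))
        (mul_nonneg (by norm_num) (tailSq_nonneg R y))
        (norm_sub_sq_le_add_tailSq R x y))
    exact (wasserstein₂_contrastLaw_le M hM hM' c hfst hsnd).trans
      (ENNReal.rpow_le_rpow (mul_le_mul_right hcost _) (by norm_num))
  have hε2 : ENNReal.ofReal (ε ^ 2) ≠ 0 := by
    rw [Ne, ENNReal.ofReal_eq_zero, not_le]; positivity
  calc P {ω | ENNReal.ofReal ε ≤
        wasserstein₂ (contrastLaw M μ) (contrastLaw M (empiricalLaw fun j => X j ω))}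
      ≤ P {ω | ENNReal.ofReal (ε ^ 2) ≤ ENNReal.ofReal (δ ^ 2 + 1) * B ω} := by
        refine measure_mono fun ω hω => ?_
        have h2 := ENNReal.rpow_le_rpow (le_trans hω (hbound ω)) (zero_le_two (α := ℝ))
        rwa [← ENNReal.rpow_mul, one_div_mul_cancel two_ne_zero, ENNReal.rpow_one,
          ENNReal.rpow_two, ← ENNReal.ofReal_pow hε.le] at h2
    _ ≤ (∫⁻ ω, ENNReal.ofReal (δ ^ 2 + 1) * B ω ∂P) / ENNReal.ofReal (ε ^ 2) :=
        meas_ge_le_lintegral_div (hBm.const_mul _) hε2 ENNReal.ofReal_ne_top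
    _ ≤ ENNReal.ofReal (δ ^ 2 + 1) * ENNReal.ofReal
          (η ^ 2 + 4 * R ^ 2 * (f.range.card * (t + 1 / (n * t))) + 8 * τ) /
            ENNReal.ofReal (ε ^ 2) := by
        rw [lintegral_const_mul' _ _ ENNReal.ofReal_ne_top]
        gcongr
    _ = _ := by
        rw [← ENNReal.ofReal_mul (by positivity), ← ENNReal.ofReal_div_of_pos (by positivity)]
        congr 1
        ring

end Convergence

theorem theorem8 {p : ℕ} (Δ₀ : Set (FiniteVarianceLaw p)) (hΔ₀ : IsCompact Δ₀)
    (F : ℕ → FiniteVarianceLaw p) (hF : ∀ n, F n ∈ Δ₀)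
    {Ω : ℕ → Type*} [∀ n, MeasurableSpace (Ω n)]
    (P : (n : ℕ) → Measure (Ω n)) [∀ n, IsProbabilityMeasure (P n)]
    (X : (n : ℕ) → Fin n → Ω n → EuclideanSpace ℝ (Fin p))
    (hX : ∀ n, ∀ j, HasLaw (X n j) (F n).law (P n))
    (hind : ∀ n, iIndepFun (X n) (P n))
    (δ : ℝ) (M : (n : ℕ) → Matrix (Fin n) (Fin p) ℝ)
    (hM_mean : ∀ n, ∀ k, ∑ j, M n j k = 0)
    (hM_sq : ∀ n, ∀ k, ∑ j, (M n j k) ^ 2 ≤ δ ^ 2) :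
    ∀ ε : ℝ, 0 < ε →
      Tendsto
        (fun n => P n {ω | ENNReal.ofReal ε ≤
          wasserstein₂ (contrastLaw (M n) (F n).law)
            (contrastLaw (M n) (empiricalLaw fun j => X n j ω))})
        atTop (𝓝 0) := by
  intro ε hε
  rw [ENNReal.tendsto_nhds_zero]
  intro e he
  obtain ⟨s, hs0, hse⟩ := ENNReal.lt_iff_exists_real_btwn.1 he
  replace hs0 : 0 < s := by simpa using hse.1
  -- Budget: after multiplication by `K`, the cell diameters cost `s / 4`, the frequencies `s / 2`,
  -- the tails `s / 4`.
  set K := (δ ^ 2 + 1) / ε ^ 2 with hK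
  have hKpos : 0 < K := by positivity
  obtain ⟨R, htail⟩ := exists_lintegral_tailSq_le hΔ₀ (τ := s / (32 * K)) (by positivity)
  obtain ⟨f, hf⟩ := exists_simpleFunc_dist_le (E := EuclideanSpace ℝ (Fin p)) R
    (η := √(s / (4 * K))) (by positivity)
  set L := 4 * R ^ 2 * f.range.card with hL
  have hL0 : 0 ≤ L := by positivity
  -- `L + 1` avoids dividing by zero when `R = 0`; `n ≥ 1 / t ^ 2` will give `1 / (n * t) ≤ t`.
  set t := s / (4 * K * (L + 1)) with ht
  have htpos : 0 < t := by positivity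
  obtain ⟨N, hN⟩ := exists_nat_ge (1 / t ^ 2)
  filter_upwards [eventually_ge_atTop N, eventually_ne_atTop 0] with n hnN hn
  have := (F n).isProbabilityMeasure_law
  refine (measure_wasserstein₂_contrastLaw_ge_le hn (hX n) (hind n) (M n) (hM_mean n) (hM_sq n)
    (by positivity) htpos hε (htail _ (hF n)) f hf).trans (le_trans ?_ hse.2.le)
  refine ENNReal.ofReal_le_ofReal ?_
  have hnt : 1 / (n * t) ≤ t := by
    have h1 : 1 / t ^ 2 ≤ n := hN.trans (by exact_mod_cast hnN)
    rw [div_le_iff₀ (by positivity)] at h1 ⊢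
    linarith
  rw [← hK, Real.sq_sqrt (by positivity)]
  have hLt : L * (t + 1 / (n * t)) ≤ s / (2 * K) := by
    calc L * (t + 1 / (n * t)) ≤ (L + 1) * (t + t) := by gcongr; linarith
      _ = s / (2 * K) := by rw [ht]; field_simp; ring
  calc K * (s / (4 * K) + 4 * R ^ 2 * (f.range.card * (t + 1 / (n * t))) + 8 * (s / (32 * K)))
      = K * (s / (4 * K) + L * (t + 1 / (n * t)) + 8 * (s / (32 * K))) := by rw [hL]; ring
    _ ≤ K * (s / (4 * K) + s / (2 * K) + 8 * (s / (32 * K))) := by gcongr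
    _ = s := by field_simp; ring
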